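/- Let $A=\begin{bmatrix}A_{11}&A_{12}\\A_{21}&A_{22}\end{bmatrix}\in\mathbb R^{n\times n}$ and $B=\begin{bmatrix}0\\B_2\end{bmatrix}\in\mathbb R^{n\times m}$ with $A_{22},B_2\in\mathbb R^{m\times m}$ and $\det B_2\neq0$, and let $(A,B)$ be stabilizable. Let $F=B_2^{-1}V^{-1}\Sigma V\,[K\;\;I]$, where $V\in\mathbb R^{m\times m}$ is invertible, $\Sigma=\mathrm{diag}(\sigma_1,\dots,\sigma_m)$ with all $\sigma_j>0$, and $K\in\mathbb R^{m\times(n-m)}$, be such that for some $Q=Q^{\mathsf T}\ge0$ and $R=R^{\mathsf T}>0$ the feedback $w=-Fz$ is a solution of the LQR problem of minimizing $\int_0^\infty (z^{\mathsf T}Qz+w^{\mathsf T}Rw)\,dt$ subject to $\dot z=Az+Bw$ (that is, for every initial state its cost is finite and minimal). Suppose that the eigenvalues of $A_{11}-A_{12}K$, counted with multiplicity, are $s_1,\dots,s_{n-m}$, where $\mathrm{Re}\,s_j<0$ and no $s_j$ is an eigenvalue of $A_{11}$. For $d_1,\dots,d_N>0$ and $\mathcal A=[a_{ij}]\in\mathbb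 R^{N\times N}$ with $a_{ij}\ge0$ and $a_{ii}=0$, put $\mathcal M=\mathrm{diag}(d_1,\dots,d_N)-\mathcal A$ and consider the closed-loop matrix $$(I_N\otimes A)-(I_N\otimes B)(\mathcal M\otimes I_m)(I_N\otimes F)\in\mathbb R^{nN\times nN}.$$ If $d_i\to\infty$ for all $i=1,\dots,N$ and $\|\mathcal A\|\to0$ (jointly, and with no relation between the rates), then the $nN$ eigenvalues of this matrix, counted with multiplicity, can be labelled $\lambda_i^j$ ($i=1,\dots,N$, $j=1,\dots,n$) in such a way that (i) $\lambda_i^j\to s_j$ for $j=1,\dots,n-m$ and $i=1,\dots,N$; (ii) $\lambda_i^{\,n-m+j}\sim-d_i\sigma_j$, i.e. $\lambda_i^{\,n-m+j}/(-d_i\sigma_j)\to1$, for $j=1,\dots,m$ and $i=1,\dots,N$. In particular the eigenvalues in (i) are dominant: $\mathrm{Re}\,\lambda_i^j-\mathrm{Re}\,\lambda_{i'}^{\,n-m+j'}\to+\infty$ for all $i,i'\in\{1,\dots,N\}$, $1\le j\le n-m$, $1\le j'\le m$. -/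

import Mathlib

open Filter Topology MeasureTheory Matrix
open scoped Kronecker ENNReal
open scoped Matrix.Norms.L2Operator

namespace CoupledLQR

/-- The complex eigenvalues of a real square matrix, with algebraic multiplicity. -/
noncomputable def eigs {κ : Type*} [Fintype κ] [DecidableEq κ] (M : Matrix κ κ ℝ) : Multiset ℂ :=
  (M.map (algebraMap ℝ ℂ)).charpoly.roots

/-- All eigenvalues lie in the open left half plane. -/
def IsHurwitz {κ : Type*} [Fintype κ] [DecidableEq κ] (M : Matrix κ κ ℝ) : Prop :=
  ∀ s ∈ eigs M, s.re < 0

/-- `(A, B)` is stabilizable: some static state feedback makes `A - B G` Hurwitz. -/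
def Stabilizable {κ μ : Type*} [Fintype κ] [DecidableEq κ] [Fintype μ]
    (A : Matrix κ κ ℝ) (B : Matrix κ μ ℝ) : Prop :=
  ∃ G : Matrix μ κ ℝ, IsHurwitz (A - B * G)

/-- `z` is the (Carathéodory) trajectory on `[0, ∞)` of `z' = A z + B w`, `z(0) = z₀`, driven by
a locally integrable input `w`. -/
structure IsTrajectory {κ μ : Type*} [Fintype κ] [Fintype μ]
    (A : Matrix κ κ ℝ) (B : Matrix κ μ ℝ) (z₀ : κ → ℝ)
    (z : ℝ → κ → ℝ) (w : ℝ → μ → ℝ) : Prop where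
  input : ∀ T : ℝ, 0 ≤ T → IntervalIntegrable w volume 0 T
  cont : ContinuousOn z (Set.Ici 0)
  eqn : ∀ T : ℝ, 0 ≤ T → z T = z₀ + ∫ t in (0 : ℝ)..T, (A *ᵥ z t + B *ᵥ w t)

/-- The quadratic cost `∫₀^∞ (zᵀ Q z + wᵀ R w) dt`, as an extended nonnegative number
(used for `Q ≥ 0`, `R > 0`, where the integrand is nonnegative). -/
noncomputable def lqrCost {κ μ : Type*} [Fintype κ] [Fintype μ]
    (Q : Matrix κ κ ℝ) (R : Matrix μ μ ℝ) (z : ℝ → κ → ℝ) (w : ℝ → μ → ℝ) : ℝ≥0∞ :=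
  ∫⁻ t in Set.Ioi (0 : ℝ), ENNReal.ofReal (z t ⬝ᵥ (Q *ᵥ z t) + w t ⬝ᵥ (R *ᵥ w t))

/-- The feedback `w = -F z` solves the LQR problem with weights `Q`, `R`: from every initial state
it has finite cost, and no other input has a smaller cost. -/
def IsLQRSolution {κ μ : Type*} [Fintype κ] [Fintype μ]
    (A : Matrix κ κ ℝ) (B : Matrix κ μ ℝ) (Q : Matrix κ κ ℝ) (R : Matrix μ μ ℝ)
    (F : Matrix μ κ ℝ) : Prop :=
  ∀ z₀ : κ → ℝ, ∃ z : ℝ → κ → ℝ,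
    IsTrajectory A B z₀ z (fun t => -(F *ᵥ z t)) ∧
    lqrCost Q R z (fun t => -(F *ᵥ z t)) < ⊤ ∧
    ∀ (z' : ℝ → κ → ℝ) (w' : ℝ → μ → ℝ), IsTrajectory A B z₀ z' w' →
      lqrCost Q R z (fun t => -(F *ᵥ z t)) ≤ lqrCost Q R z' w'

/-- The input matrix `[0; B₂]`. -/
def inputMatrix {p m : ℕ} (B₂ : Matrix (Fin m) (Fin m) ℝ) :
    Matrix (Fin p ⊕ Fin m) (Fin m) ℝ :=
  Matrix.fromRows 0 B₂

/-- The gain `F = B₂⁻¹ V⁻¹ diag(σ) V [K  I]`. -/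
noncomputable def gain {p m : ℕ} (B₂ V : Matrix (Fin m) (Fin m) ℝ) (σ : Fin m → ℝ)
    (K : Matrix (Fin m) (Fin p) ℝ) : Matrix (Fin m) (Fin p ⊕ Fin m) ℝ :=
  B₂⁻¹ * V⁻¹ * Matrix.diagonal σ * V * Matrix.fromCols K 1

/-- The closed-loop matrix `(I ⊗ A) - (I ⊗ B) ((D - C) ⊗ I) (I ⊗ F)` of the network, where
`D = diag(d)` collects the self-feedback gains and `C` the coupling weights. -/
def closedLoop {N : ℕ} {κ μ : Type*} [Fintype κ] [DecidableEq κ] [Fintype μ] [DecidableEq μ]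
    (A : Matrix κ κ ℝ) (B : Matrix κ μ ℝ) (F : Matrix μ κ ℝ)
    (d : Fin N → ℝ) (C : Matrix (Fin N) (Fin N) ℝ) :
    Matrix (Fin N × κ) (Fin N × κ) ℝ :=
  ((1 : Matrix (Fin N) (Fin N) ℝ) ⊗ₖ A) -
    ((1 : Matrix (Fin N) (Fin N) ℝ) ⊗ₖ B) *
      ((Matrix.diagonal d - C) ⊗ₖ (1 : Matrix μ μ ℝ)) *
      ((1 : Matrix (Fin N) (Fin N) ℝ) ⊗ₖ F)

end CoupledLQR

namespace CoupledLQR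

/-! In the coordinates `(x₁, V(K x₁ + x₂))` the matrix `BF` becomes `diag(0, σ)` and the upper left
block of `A` becomes `H = A₁₁ - A₁₂ K`. The closed loop is then similar to a block diagonal `Y` with
blocks `diag(H, -dᵢ Σ)` plus a convergent `Δ` (`exists_charpoly_closedLoop`). The eigenvalues of `Y`
are the claimed asymptotics, so it remains to compare roots.

With `W = (u - Y)⁻¹`, the ratio of characteristic polynomials at `u` is `det(1 - WΔ)`. It tends to 1
at fixed `u` off the spectrum of `H`, since only the `H` part of `W` survives and the limit of `Δ`
vanishes on that block. It also tends to 1 when `u` escapes together with its distances to the fast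
eigenvalues, since then `W → 0`.

Ratios tending to 1 at the scale of each reference root force a matching of roots
(`exists_relabel_relClose`). Along an ultrafilter every rescaled root converges or escapes, so each
rescaled polynomial has a limit, whose roots count a class of relatively close roots. Treating one
scale at a time makes any relation between the rates of the `dᵢ` unnecessary. -/

/-! ### Matching the roots of two polynomial families -/

open Polynomial in
/-- Along an ultrafilter, the suitably normalised products `∏ (z - f a)` converge to a monic
polynomial whose roots are the finite limits of the `f a`. -/
theorem exists_limit_polynomial {α ι : Type*} [Fintype α] (𝓤 : Ultrafilter ι) (f : α → ι → ℂ) :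
    ∃ (P : ℂ[X]) (c : ι → ℂ), P.Monic ∧ (∀ᶠ t in 𝓤, c t ≠ 0) ∧
      (∀ z, Tendsto (fun t => (∏ a, (z - f a t)) / c t) 𝓤 (𝓝 (P.eval z))) ∧
      ∀ x, P.roots.count x = Nat.card {a // Tendsto (f a) 𝓤 (𝓝 x)} := by
  classical
  have dich : ∀ a, (∃ w, Tendsto (f a) 𝓤 (𝓝 w)) ∨ Tendsto (f a) 𝓤 (Bornology.cobounded ℂ) := by
    intro a
    by_cases h : ∃ r : ℝ, ∀ᶠ t in 𝓤, ‖f a t‖ ≤ r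
    · obtain ⟨r, hr⟩ := h
      left
      have hc : IsCompact (Metric.closedBall (0 : ℂ) r) := isCompact_closedBall 0 r
      obtain ⟨w, -, hw⟩ := hc.ultrafilter_le_nhds (𝓤.map (f a)) (by
        rw [le_principal_iff]
        change ∀ᶠ t in 𝓤, f a t ∈ Metric.closedBall (0 : ℂ) r
        filter_upwards [hr] with t ht
        simpa using ht)
      exact ⟨w, hw⟩
    · right
      simp only [not_exists, ← Ultrafilter.eventually_not, not_le] at h
      rw [← tendsto_norm_atTop_iff_cobounded, tendsto_atTop]
      intro r
      filter_upwards [h r] with t ht using ht.le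
  let S : Finset α := Finset.univ.filter fun a => ∃ w, Tendsto (f a) 𝓤 (𝓝 w)
  have hS : ∀ a, ∃ w, a ∈ S → Tendsto (f a) 𝓤 (𝓝 w) := by
    intro a
    by_cases h : ∃ w, Tendsto (f a) 𝓤 (𝓝 w)
    · exact h.imp fun w hw _ => hw
    · exact ⟨0, fun h' => absurd (by simpa [S] using h') h⟩
  choose w hw using hS
  have hinf : ∀ a ∈ Sᶜ, Tendsto (f a) 𝓤 (Bornology.cobounded ℂ) := fun a ha =>
    (dich a).resolve_left (by simpa [S] using ha)
  have hne : ∀ a ∈ Sᶜ, ∀ᶠ t in 𝓤, f a t ≠ 0 := fun a ha =>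
    (hinf a ha).eventually (Bornology.eventually_ne_cobounded 0)
  -- Dividing an escaping factor by `-f a` turns it into `1 - z / f a → 1`, so only the convergent
  -- roots remain.
  refine ⟨∏ a ∈ S, (X - C (w a)), fun t => ∏ a ∈ Sᶜ, -f a t, monic_prod_X_sub_C _ _, ?_, ?_, ?_⟩
  · have := (Finset.eventually_all Sᶜ).2 hne
    filter_upwards [this] with t ht
    exact Finset.prod_ne_zero_iff.2 fun a ha => neg_ne_zero.2 (ht a ha)
  · intro z
    have h1 : Tendsto (fun t => ∏ a ∈ S, (z - f a t)) 𝓤 (𝓝 (∏ a ∈ S, (z - w a))) :=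
      tendsto_finsetProd _ fun a ha => (hw a ha).const_sub z
    have h2 : Tendsto (fun t => ∏ a ∈ Sᶜ, ((z - f a t) / (-f a t))) 𝓤 (𝓝 (∏ a ∈ Sᶜ, (1 : ℂ))) := by
      refine tendsto_finsetProd _ fun a ha => ?_
      have h3 : Tendsto (fun t => 1 - z * (f a t)⁻¹) 𝓤 (𝓝 (1 - z * 0)) :=
        ((tendsto_inv₀_cobounded.comp (hinf a ha)).const_mul z).const_sub 1
      rw [mul_zero, sub_zero] at h3
      refine h3.congr' ?_
      filter_upwards [hne a ha] with t ht
      field_simp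
      ring
    have h3 := h1.mul h2
    rw [eval_prod]
    simp only [eval_sub, eval_X, eval_C]
    rw [Finset.prod_const_one, mul_one] at h3
    refine h3.congr fun t => ?_
    rw [Finset.prod_div_distrib, mul_div_assoc', Finset.prod_mul_prod_compl]
  · intro x
    have hr : (∏ a ∈ S, (X - C (w a))).roots = S.val.map w := by
      rw [← roots_multiset_prod_X_sub_C (S.val.map w), Multiset.map_map]
      rfl
    rw [hr, Multiset.count_map, Nat.card_eq_fintype_card, Fintype.card_subtype]
    change (S.filter fun a => x = w a).card = _
    congr 1
    ext a
    simp only [Finset.mem_filter, Finset.mem_univ, true_and]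
    constructor
    · rintro ⟨ha, rfl⟩
      exact hw a ha
    · intro h
      have ha : a ∈ S := by simpa [S] using ⟨x, h⟩
      exact ⟨ha, tendsto_nhds_unique h (hw a ha)⟩

/-- If `∏ (z - f a) / ∏ (z - g a) → 1` for infinitely many `z`, then `f` and `g` have the same
finite limits, with multiplicity. -/
theorem card_tendsto_eq_of_prod_ratio {α ι : Type*} [Fintype α] (𝓤 : Ultrafilter ι)
    (f g : α → ι → ℂ) {Z : Set ℂ} (hZ : Z.Infinite)
    (h : ∀ z ∈ Z, Tendsto (fun t => (∏ a, (z - f a t)) / ∏ a, (z - g a t)) 𝓤 (𝓝 1)) (x : ℂ) :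
    Nat.card {a // Tendsto (f a) 𝓤 (𝓝 x)} = Nat.card {a // Tendsto (g a) 𝓤 (𝓝 x)} := by
  obtain ⟨P, c, hP, hc, hPl, hPr⟩ := exists_limit_polynomial 𝓤 f
  obtain ⟨Q, e, hQ, he, hQl, hQr⟩ := exists_limit_polynomial 𝓤 g
  suffices P = Q by rw [← hPr, ← hQr, this]
  have hZ' : (Z \ {z | Q.IsRoot z}).Infinite :=
    hZ.sdiff (Polynomial.finite_setOfPred_isRoot hQ.ne_zero)
  -- The ratio of normalisers does not involve `z`, so `P / Q` is constant on an infinite set, and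
  -- monicity makes the constant 1.
  have key : ∀ z ∈ Z \ {z | Q.IsRoot z},
      Tendsto (fun t => e t / c t) 𝓤 (𝓝 (P.eval z / Q.eval z)) := by
    rintro z ⟨hz, hz'⟩
    have h1 := ((hPl z).div (hQl z) hz').div (h z hz) one_ne_zero
    rw [div_one] at h1
    refine h1.congr' ?_
    filter_upwards [hc, he, (h z hz).eventually_ne one_ne_zero] with t hct het hr
    have hf : ∏ a, (z - f a t) ≠ 0 := fun h0 => hr (by simp [h0])
    have hg : ∏ a, (z - g a t) ≠ 0 := fun h0 => hr (by simp [h0])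
    simp only [Pi.div_apply]
    field_simp
  obtain ⟨z₀, hz₀⟩ := hZ'.nonempty
  set k := P.eval z₀ / Q.eval z₀
  have hPQ : P = Polynomial.C k * Q := by
    refine Polynomial.eq_of_infinite_eval_eq _ _ (hZ'.mono fun z hz => ?_)
    have := tendsto_nhds_unique (key z hz) (key z₀ hz₀)
    have hz' : Q.eval z ≠ 0 := hz.2
    rw [div_eq_iff hz'] at this
    simpa using this
  have hk : k = 1 := by
    have := congrArg Polynomial.leadingCoeff hPQ
    rw [Polynomial.leadingCoeff_mul, hP.leadingCoeff, hQ.leadingCoeff] at this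
    simpa using this.symm
  rw [hPQ, hk]
  simp

/-- Two colourings of a finite type with the same colour counts differ by a permutation. -/
theorem exists_perm_of_card_fiber_le {α κ : Type*} [Finite α] (c c' : α → κ)
    (h : ∀ b, Nat.card {a // c' a = c' b} ≤ Nat.card {a // c a = c' b}) :
    ∃ π : Equiv.Perm α, ∀ b, c (π b) = c' b := by
  classical
  have := Fintype.ofFinite α
  have hq : ∀ q, Nonempty ({a // c' a = q} ↪ {a // c a = q}) := by
    intro q
    by_cases hb : ∃ b, c' b = q
    · obtain ⟨b, rfl⟩ := hb
      refine Function.Embedding.nonempty_of_card_le ?_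
      simpa only [Nat.card_eq_fintype_card] using h b
    · have : IsEmpty {a // c' a = q} := ⟨fun a => hb ⟨a.1, a.2⟩⟩
      exact ⟨Function.Embedding.ofIsEmpty⟩
  let e := fun q => (hq q).some
  let F : α → α := fun b => (e (c' b) ⟨b, rfl⟩).1
  have hF : ∀ b, c (F b) = c' b := fun b => (e (c' b) ⟨b, rfl⟩).2
  have hFe : ∀ q b (hb : c' b = q), F b = (e q ⟨b, hb⟩).1 := by
    rintro q b rfl
    rfl
  have hinj : Function.Injective F := by
    intro b b' hbb
    have hc : c' b = c' b' := by rw [← hF b, ← hF b', hbb]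
    rw [hFe _ b hc, hFe _ b' rfl] at hbb
    exact congrArg Subtype.val ((e _).injective (Subtype.ext hbb))
  exact ⟨Equiv.ofBijective F (Finite.injective_iff_bijective.1 hinj), hF⟩

/-- Relative closeness of complex functions along a filter. -/
def RelClose {ι : Type*} (l : Filter ι) (f g : ι → ℂ) : Prop :=
  Tendsto (fun t => ‖f t - g t‖ / (1 + ‖g t‖)) l (𝓝 0)

theorem RelClose.refl {ι : Type*} (l : Filter ι) (f : ι → ℂ) : RelClose l f f := by
  simpa [RelClose] using tendsto_const_nhds

/-- Relative closeness allows the denominator to be changed. -/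
theorem RelClose.norm_sub_div {ι : Type*} {l : Filter ι} {f g h k : ι → ℂ} (hfg : RelClose l f g)
    (hhk : Tendsto (fun t => ‖h t - k t‖ / (1 + ‖g t‖)) l (𝓝 0)) :
    Tendsto (fun t => ‖h t - k t‖ / (1 + ‖f t‖)) l (𝓝 0) := by
  -- Below `1/2` the error is absorbed: `1 + ‖g‖ ≤ 2 (1 + ‖f‖)`.
  have hlt : ∀ᶠ t in l, ‖f t - g t‖ / (1 + ‖g t‖) < 1 / 2 :=
    hfg.eventually_lt_const (by norm_num)
  refine squeeze_zero' (Eventually.of_forall fun t => by positivity) ?_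
    (by simpa using hhk.const_mul 2)
  filter_upwards [hlt] with t ht
  have hg : (0 : ℝ) < 1 + ‖g t‖ := by positivity
  rw [div_lt_iff₀ hg] at ht
  have h3 : ‖g t‖ ≤ ‖f t‖ + ‖f t - g t‖ := by
    simpa [norm_sub_rev] using norm_le_norm_add_norm_sub (f t) (g t)
  rw [mul_div_assoc', div_le_div_iff₀ (by positivity) hg]
  nlinarith [norm_nonneg (h t - k t)]

theorem RelClose.symm {ι : Type*} {l : Filter ι} {f g : ι → ℂ} (h : RelClose l f g) :
    RelClose l g f := by
  refine h.norm_sub_div ?_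
  simpa only [RelClose, norm_sub_rev] using h

theorem RelClose.trans {ι : Type*} {l : Filter ι} {f g h : ι → ℂ} (h₁ : RelClose l f g)
    (h₂ : RelClose l g h) : RelClose l f h := by
  have h₃ := h₂.symm.norm_sub_div h₁
  refine squeeze_zero (fun t => by positivity) (fun t => ?_) (by simpa using h₃.add h₂)
  rw [← add_div]
  gcongr
  exact norm_sub_le_norm_sub_add_norm_sub _ _ _

/-- The setoid of relatively close functions. -/
def relCloseSetoid {ι : Type*} (l : Filter ι) : Setoid (ι → ℂ) where
  r := RelClose l
  iseqv := ⟨RelClose.refl l, RelClose.symm, RelClose.trans⟩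

/-- Matching along an ultrafilter of two families of complex functions. -/
theorem exists_perm_relClose {α ι : Type*} [Fintype α] (𝓤 : Ultrafilter ι) (f g : α → ι → ℂ)
    (h : ∀ b, ∃ Z : Set ℂ, Z.Infinite ∧ ∀ z ∈ Z, Tendsto (fun t =>
      (∏ a, (((1 + ‖g b t‖ : ℝ) : ℂ) * z - f a t)) / ∏ a, (((1 + ‖g b t‖ : ℝ) : ℂ) * z - g a t))
      𝓤 (𝓝 1)) :
    ∃ π : Equiv.Perm α, ∀ b, RelClose 𝓤 (f (π b)) (g b) := by
  let cls : (ι → ℂ) → Quotient (relCloseSetoid (𝓤 : Filter ι)) := Quotient.mk _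
  have hcls : ∀ f g, cls f = cls g ↔ RelClose 𝓤 f g := fun f g => Quotient.eq
  obtain ⟨π, hπ⟩ := exists_perm_of_card_fiber_le (fun a => cls (f a)) (fun a => cls (g a)) (by
    intro b
    obtain ⟨Z, hZ, hlim⟩ := h b
    let ρ : ι → ℂ := fun t => ((1 + ‖g b t‖ : ℝ) : ℂ)
    have hρn : ∀ t, ‖ρ t‖ = 1 + ‖g b t‖ := fun t => by
      rw [Complex.norm_real, Real.norm_of_nonneg (by positivity)]
    have hρ0 : ∀ t, ρ t ≠ 0 := fun t => by
      rw [← norm_ne_zero_iff, hρn]; positivity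
    obtain ⟨w, hw⟩ : ∃ w, Tendsto (fun t => g b t / ρ t) 𝓤 (𝓝 w) := by
      have hc : IsCompact (Metric.closedBall (0 : ℂ) 1) := isCompact_closedBall 0 1
      obtain ⟨w, -, hw⟩ := hc.ultrafilter_le_nhds (𝓤.map fun t => g b t / ρ t) (by
        rw [le_principal_iff]
        change ∀ᶠ t in 𝓤, g b t / ρ t ∈ Metric.closedBall (0 : ℂ) 1
        refine Eventually.of_forall fun t => ?_
        rw [mem_closedBall_zero_iff, norm_div, hρn, div_le_one (by positivity)]
        linarith)
      exact ⟨w, hw⟩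
    -- After division by `ρ`, the class of `g b` is exactly the set of functions with limit `w`, so
    -- class sizes are root multiplicities of a limit polynomial.
    have hiff : ∀ u : ι → ℂ, cls u = cls (g b) ↔ Tendsto (fun t => u t / ρ t) 𝓤 (𝓝 w) := by
      intro u
      have h0 : RelClose 𝓤 u (g b) ↔ Tendsto (fun t => u t / ρ t - g b t / ρ t) 𝓤 (𝓝 0) := by
        rw [tendsto_zero_iff_norm_tendsto_zero, RelClose]
        simp only [← sub_div, norm_div, hρn]
      rw [hcls, h0]
      constructor
      · intro h1
        simpa using h1.add hw
      · intro h1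
        simpa using h1.sub hw
    simp only [hiff]
    refine (card_tendsto_eq_of_prod_ratio 𝓤 (fun a t => f a t / ρ t) (fun a t => g a t / ρ t) hZ
      (fun z hz => (hlim z hz).congr fun t => ?_) w).ge
    have hsc : ∀ u : α → ℂ, ∏ a, (ρ t * z - u a) = ρ t ^ Fintype.card α * ∏ a, (z - u a / ρ t) := by
      intro u
      rw [← Finset.card_univ, ← Finset.prod_const, ← Finset.prod_mul_distrib]
      refine Finset.prod_congr rfl fun a _ => ?_
      rw [mul_sub, mul_div_cancel₀ _ (hρ0 t)]
    change (∏ a, (ρ t * z - f a t)) / (∏ a, (ρ t * z - g a t)) = _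
    rw [hsc fun a => f a t, hsc fun a => g a t, mul_div_mul_left _ _ (pow_ne_zero _ (hρ0 t))])
  exact ⟨π, fun b => (hcls _ _).1 (hπ b)⟩

/-- If the monic polynomials with roots `f` and `g` have ratio tending to `1` at the scale of each
`g b`, then the roots `f` can be relabelled so as to be relatively close to the roots `g`. -/
theorem exists_relabel_relClose {α ι : Type*} [Fintype α] (l : Filter ι) (f g : α → ι → ℂ)
    (h : ∀ b, ∃ Z : Set ℂ, Z.Infinite ∧ ∀ z ∈ Z, Tendsto (fun t =>
      (∏ a, (((1 + ‖g b t‖ : ℝ) : ℂ) * z - f a t)) / ∏ a, (((1 + ‖g b t‖ : ℝ) : ℂ) * z - g a t))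
      l (𝓝 1)) :
    ∃ π : ι → Equiv.Perm α, ∀ b, RelClose l (fun t => f (π t b) t) (g b) := by
  classical
  -- The permutation found along an ultrafilter depends on it; minimising the total error for each
  -- `t` gives one choice that works for all ultrafilters.
  let err : ι → Equiv.Perm α → ℝ := fun t π => ∑ b, ‖f (π b) t - g b t‖ / (1 + ‖g b t‖)
  have hmin : ∀ t, ∃ π, ∀ π', err t π ≤ err t π' := fun t => Finite.exists_min (err t)
  choose π hπ using hmin
  have hlim : Tendsto (fun t => err t (π t)) l (𝓝 0) := by
    rw [tendsto_iff_ultrafilter]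
    intro 𝓤 h𝓤
    obtain ⟨π', hπ'⟩ := exists_perm_relClose 𝓤 f g fun b =>
      (h b).imp fun Z hZ => ⟨hZ.1, fun z hz => (hZ.2 z hz).mono_left h𝓤⟩
    have hs : Tendsto (fun t => err t π') 𝓤 (𝓝 0) := by
      simpa using tendsto_finsetSum Finset.univ fun b _ => hπ' b
    exact squeeze_zero (fun t => Finset.sum_nonneg fun b _ => by positivity)
      (fun t => hπ t π') hs
  refine ⟨π, fun b => squeeze_zero (fun t => by positivity) (fun t => ?_) hlim⟩
  exact Finset.single_le_sum (f := fun b => ‖f (π t b) t - g b t‖ / (1 + ‖g b t‖))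
    (fun b _ => by positivity) (Finset.mem_univ b)

/-! ### Ratios of characteristic polynomials -/

/-- The characteristic polynomial of a perturbed block diagonal matrix, relative to that of the
unperturbed one, at a point where the resolvents `W` of the blocks converge. -/
theorem tendsto_charpoly_ratio {o κ ι : Type*} [Fintype o] [DecidableEq o] [Fintype κ]
    [DecidableEq κ] {l : Filter ι} {Y W : ι → o → Matrix κ κ ℂ} {W₀ : o → Matrix κ κ ℂ}
    {Δ : ι → Matrix (κ × o) (κ × o) ℂ} {Δ₀ : Matrix (κ × o) (κ × o) ℂ} {u : ι → ℂ}
    (hW : ∀ᶠ t in l, ∀ i, W t i * (scalar κ (u t) - Y t i) = 1)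
    (hWl : Tendsto W l (𝓝 W₀)) (hΔ : Tendsto Δ l (𝓝 Δ₀))
    (hdet : det (1 - blockDiagonal W₀ * Δ₀) = 1) :
    Tendsto (fun t => (blockDiagonal (Y t) + Δ t).charpoly.eval (u t) /
      ∏ i, (Y t i).charpoly.eval (u t)) l (𝓝 1) := by
  have hcont : Continuous fun x : (o → Matrix κ κ ℂ) × Matrix (κ × o) (κ × o) ℂ =>
      det (1 - blockDiagonal x.1 * x.2) :=
    (continuous_const.sub (continuous_fst.matrix_blockDiagonal.matrix_mul
      continuous_snd)).matrix_det
  have hl := (hcont.tendsto (W₀, Δ₀)).comp (hWl.prodMk_nhds hΔ)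
  simp only [hdet] at hl
  refine hl.congr' ?_
  filter_upwards [hW] with t ht
  have hmul : blockDiagonal (W t) * (scalar (κ × o) (u t) - blockDiagonal (Y t)) = 1 := by
    have hs : scalar (κ × o) (u t) = blockDiagonal fun _ : o => scalar κ (u t) := by
      simp [scalar_apply, blockDiagonal_diagonal]
    rw [hs, ← blockDiagonal_sub, ← blockDiagonal_mul, ← blockDiagonal_one]
    exact congrArg _ (funext ht)
  have hdet1 : (blockDiagonal (W t)).det * ∏ i, (scalar κ (u t) - Y t i).det = 1 := by
    rw [det_blockDiagonal, ← Finset.prod_mul_distrib]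
    exact Finset.prod_eq_one fun i _ => by rw [← det_mul, ht i, det_one]
  have hne := right_ne_zero_of_mul_eq_one hdet1
  simp only [eval_charpoly, Function.comp]
  rw [eq_div_iff hne, ← hmul, ← mul_sub, sub_sub, det_mul, mul_right_comm, hdet1, one_mul]

/-- The resolvent of a block diagonal matrix with one diagonal block. -/
theorem resolvent_fromBlocks_mul {p m : Type*} [Fintype p] [DecidableEq p] [Fintype m]
    [DecidableEq m] {H : Matrix p p ℂ} {μ : m → ℂ} {u : ℂ} (hH : (scalar p u - H).det ≠ 0)
    (hμ : ∀ j, u - μ j ≠ 0) :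
    fromBlocks (scalar p u - H)⁻¹ 0 0 (diagonal fun j => (u - μ j)⁻¹) *
      (scalar (p ⊕ m) u - fromBlocks H 0 0 (diagonal μ)) = 1 := by
  have hs : scalar (p ⊕ m) u = fromBlocks (scalar p u) 0 0 (scalar m u) := by
    rw [scalar_apply, scalar_apply, scalar_apply, fromBlocks_diagonal]
    congr 1
    ext (_ | _) <;> rfl
  have hd : scalar m u - diagonal μ = diagonal fun j => u - μ j := by
    simp [scalar_apply, diagonal_sub]
  rw [hs, sub_eq_add_neg (fromBlocks _ _ _ _), fromBlocks_neg, fromBlocks_add, fromBlocks_multiply]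
  simp only [neg_zero, add_zero, Matrix.mul_zero, Matrix.zero_mul, zero_add, ← sub_eq_add_neg, hd,
    diagonal_mul_diagonal, inv_mul_cancel₀ (hμ _), diagonal_one,
    nonsing_inv_mul _ (isUnit_iff_ne_zero.2 hH), fromBlocks_one]

section
variable {o p m ι : Type*} [Fintype o] [DecidableEq o] [Fintype p] [DecidableEq p] [Fintype m]
  [DecidableEq m] {l : Filter ι} {H : Matrix p p ℂ} {μ : ι → o → m → ℂ}
  {Δ : ι → Matrix ((p ⊕ m) × o) ((p ⊕ m) × o) ℂ}

/-- At a fixed point outside the spectrum of `H`. -/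
theorem tendsto_charpoly_ratio_const {G : Matrix p m ℂ} {E : Matrix m p ℂ} {P : Matrix m m ℂ}
    (hΔ : Tendsto Δ l (𝓝 (blockDiagonal fun _ => fromBlocks 0 G E P))) {u : ℂ}
    (hH : (scalar p u - H).det ≠ 0)
    (hμ : ∀ i j, Tendsto (fun t => μ t i j) l (Bornology.cobounded ℂ)) :
    Tendsto (fun t => (blockDiagonal (fun i => fromBlocks H 0 0 (diagonal (μ t i))) +
      Δ t).charpoly.eval u /
      ∏ i, (fromBlocks H 0 0 (diagonal (μ t i))).charpoly.eval u) l (𝓝 1) := by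
  have hcob : ∀ i j, Tendsto (fun t => u - μ t i j) l (Bornology.cobounded ℂ) := fun i j =>
    (tendsto_const_sub_cobounded u).comp (hμ i j)
  refine tendsto_charpoly_ratio (u := fun _ => u)
    (W := fun t i => fromBlocks (scalar p u - H)⁻¹ 0 0 (diagonal fun j => (u - μ t i j)⁻¹))
    (W₀ := fun _ => fromBlocks (scalar p u - H)⁻¹ 0 0 0) ?_ ?_ hΔ ?_
  · have : ∀ᶠ t in l, ∀ i j, u - μ t i j ≠ 0 := eventually_all.2 fun i => eventually_all.2 fun j =>
      (hcob i j).eventually (Bornology.eventually_ne_cobounded 0)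
    filter_upwards [this] with t ht i
    exact resolvent_fromBlocks_mul hH (ht i)
  · rw [tendsto_pi_nhds]
    intro i
    have hcont : Continuous fun x : m → ℂ =>
        fromBlocks (scalar p u - H)⁻¹ 0 0 (diagonal x) :=
      Continuous.matrix_fromBlocks continuous_const continuous_const continuous_const
        continuous_id.matrix_diagonal
    have hx : Tendsto (fun t j => (u - μ t i j)⁻¹) l (𝓝 0) :=
      tendsto_pi_nhds.2 fun j => tendsto_inv₀_cobounded.comp (hcob i j)
    simpa [Function.comp_def] using (hcont.tendsto 0).comp hx
  -- Each block of `1 - W₀ Δ₀` is upper triangular with unit diagonal, thanks to the zero upper left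
  -- block of the limit.
  · rw [← blockDiagonal_mul, ← blockDiagonal_one, ← blockDiagonal_sub, det_blockDiagonal]
    refine Finset.prod_eq_one fun i _ => ?_
    simp only [Pi.sub_apply, Pi.one_apply]
    rw [fromBlocks_multiply, ← fromBlocks_one, sub_eq_add_neg, fromBlocks_neg, fromBlocks_add]
    simp

/-- At points that tend to infinity together with their distances to the `μ`. -/
theorem tendsto_charpoly_ratio_cobounded {Δ₀ : Matrix ((p ⊕ m) × o) ((p ⊕ m) × o) ℂ}
    (hΔ : Tendsto Δ l (𝓝 Δ₀)) {u : ι → ℂ} (hu : Tendsto u l (Bornology.cobounded ℂ))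
    (hμ : ∀ i j, Tendsto (fun t => u t - μ t i j) l (Bornology.cobounded ℂ)) :
    Tendsto (fun t => (blockDiagonal (fun i => fromBlocks H 0 0 (diagonal (μ t i))) +
      Δ t).charpoly.eval (u t) /
      ∏ i, (fromBlocks H 0 0 (diagonal (μ t i))).charpoly.eval (u t)) l (𝓝 1) := by
  refine tendsto_charpoly_ratio
    (W := fun t i => fromBlocks (scalar p (u t) - H)⁻¹ 0 0 (diagonal fun j => (u t - μ t i j)⁻¹))
    (W₀ := 0) ?_ ?_ hΔ ?_
  · have h1 : ∀ᶠ t in l, ∀ i j, u t - μ t i j ≠ 0 :=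
      eventually_all.2 fun i => eventually_all.2 fun j =>
        (hμ i j).eventually (Bornology.eventually_ne_cobounded 0)
    have h2 : ∀ᶠ t in l, (scalar p (u t) - H).det ≠ 0 := by
      have hfin : {z | H.charpoly.IsRoot z}.Finite :=
        Polynomial.finite_setOfPred_isRoot H.charpoly_monic.ne_zero
      have := hu.eventually (Bornology.isBounded_def.1 hfin.isBounded)
      filter_upwards [this] with t ht
      simpa [Polynomial.IsRoot, eval_charpoly] using ht
    filter_upwards [h1, h2] with t ht ht' i
    exact resolvent_fromBlocks_mul ht' (ht i)
  · rw [tendsto_pi_nhds]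
    intro i
    have hcont : Continuous fun x : Matrix p p ℂ × (m → ℂ) =>
        fromBlocks x.1 0 0 (diagonal x.2) :=
      Continuous.matrix_fromBlocks continuous_fst continuous_const continuous_const
        continuous_snd.matrix_diagonal
    have hx : Tendsto (fun t j => (u t - μ t i j)⁻¹) l (𝓝 0) :=
      tendsto_pi_nhds.2 fun j => tendsto_inv₀_cobounded.comp (hμ i j)
    have hr : Tendsto (fun t => (scalar p (u t) - H)⁻¹) l (𝓝 0) := by
      refine ((spectrum.resolvent_tendsto_cobounded H).comp hu).congr fun t => ?_
      rw [nonsing_inv_eq_ringInverse]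
      rfl
    simpa [Function.comp_def] using (hcont.tendsto (0, 0)).comp (hr.prodMk_nhds hx)
  · have : blockDiagonal (0 : o → Matrix (p ⊕ m) (p ⊕ m) ℂ) = 0 := blockDiagonal_zero
    rw [this, zero_mul, sub_zero, det_one]

end

/-! ### Eigenvalue enumerations and coordinates for the closed loop -/

theorem exists_enumeration {α β : Type*} [Fintype α] (s : Multiset β)
    (h : s.card = Fintype.card α) : ∃ f : α → β, s = Finset.univ.val.map f := by
  have e : α ≃ Fin s.toList.length := Fintype.equivFinOfCardEq (by simp [h])
  refine ⟨fun a => s.toList.get (e a), ?_⟩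
  have h1 : (Finset.univ.val.map fun a => s.toList.get (e a)) =
      (Finset.univ.val.map e).map s.toList.get := by
    rw [Multiset.map_map]; rfl
  rw [h1, Multiset.map_univ_val_equiv, Fin.univ_val_map, List.ofFn_get, Multiset.coe_toList]

theorem exists_eigs_eq {κ : Type*} [Fintype κ] [DecidableEq κ] (M : Matrix κ κ ℝ) :
    ∃ f : κ → ℂ, eigs M = Finset.univ.val.map f := by
  refine exists_enumeration _ ?_
  rw [eigs, Polynomial.splits_iff_card_roots.1 (IsAlgClosed.splits _), charpoly_natDegree_eq_dim]

theorem eval_charpoly_eq_prod_of_eigs {κ α : Type*} [Fintype κ] [DecidableEq κ] [Fintype α]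
    {M : Matrix κ κ ℝ} {f : α → ℂ} (h : eigs M = Finset.univ.val.map f) (u : ℂ) :
    (M.map (algebraMap ℝ ℂ)).charpoly.eval u = ∏ a, (u - f a) := by
  rw [(IsAlgClosed.splits (M.map (algebraMap ℝ ℂ)).charpoly).eval_eq_prod_roots_of_monic
    (charpoly_monic _)]
  change (Multiset.map _ (eigs M)).prod = _
  rw [h, Multiset.map_map]
  rfl

theorem charpoly_conj {κ : Type*} [Fintype κ] [DecidableEq κ] {T T' : Matrix κ κ ℝ}
    (h : T * T' = 1) (M : Matrix κ κ ℝ) : (T * M * T').charpoly = M.charpoly := by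
  rw [Matrix.mul_assoc, charpoly_mul_comm, Matrix.mul_assoc, mul_eq_one_comm.1 h, Matrix.mul_one]

/-- The mixed product rule collapses the feedback term to `(D - C) ⊗ BF`, and `I ⊗ T` conjugates
both terms. Swapping the tensor factors then matches the index order of `blockDiagonal`. -/
theorem charpoly_closedLoop_conj {N : ℕ} {κ μ : Type*} [Fintype κ] [DecidableEq κ] [Fintype μ]
    [DecidableEq μ] (A : Matrix κ κ ℝ) (B : Matrix κ μ ℝ) (F : Matrix μ κ ℝ)
    {T T' : Matrix κ κ ℝ} (h : T * T' = 1) (d : Fin N → ℝ) (C : Matrix (Fin N) (Fin N) ℝ) :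
    (closedLoop A B F d C).charpoly =
      ((T * A * T') ⊗ₖ 1 - (T * (B * F) * T') ⊗ₖ (diagonal d - C)).charpoly := by
  have h1 : closedLoop A B F d C = 1 ⊗ₖ A - (diagonal d - C) ⊗ₖ (B * F) := by
    rw [closedLoop, ← mul_kronecker_mul, ← mul_kronecker_mul, Matrix.one_mul, Matrix.mul_one,
      Matrix.mul_one]
  have hS : ((1 : Matrix (Fin N) (Fin N) ℝ) ⊗ₖ T) * (1 ⊗ₖ T') = 1 := by
    rw [← mul_kronecker_mul, h, Matrix.one_mul, one_kronecker_one]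
  rw [h1, ← charpoly_conj hS, Matrix.mul_sub, Matrix.sub_mul, ← mul_kronecker_mul,
    ← mul_kronecker_mul, ← mul_kronecker_mul, ← mul_kronecker_mul, Matrix.one_mul, Matrix.mul_one,
    Matrix.one_mul, Matrix.mul_one, ← charpoly_reindex (Equiv.prodComm _ _)]
  congr 1
  ext ⟨a, i⟩ ⟨b, j⟩
  simp [mul_comm]

/-- In suitable coordinates the closed loop is a bounded perturbation of a block diagonal matrix
with blocks `A₁₁ - A₁₂ K` and `-dᵢ Σ`. -/
theorem exists_charpoly_closedLoop {p m N : ℕ}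
    (A₁₁ : Matrix (Fin p) (Fin p) ℝ) (A₁₂ : Matrix (Fin p) (Fin m) ℝ)
    (A₂₁ : Matrix (Fin m) (Fin p) ℝ) (A₂₂ : Matrix (Fin m) (Fin m) ℝ)
    {B₂ : Matrix (Fin m) (Fin m) ℝ} (hB₂ : B₂.det ≠ 0)
    {V : Matrix (Fin m) (Fin m) ℝ} (hV : V.det ≠ 0)
    (σ : Fin m → ℝ) (K : Matrix (Fin m) (Fin p) ℝ) :
    ∃ (G : Matrix (Fin p) (Fin m) ℂ) (E : Matrix (Fin m) (Fin p) ℂ) (P : Matrix (Fin m) (Fin m) ℂ),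
      ∀ (d : Fin N → ℝ) (C : Matrix (Fin N) (Fin N) ℝ),
        ((closedLoop (fromBlocks A₁₁ A₁₂ A₂₁ A₂₂) (inputMatrix B₂) (gain B₂ V σ K) d C).map
          (algebraMap ℝ ℂ)).charpoly =
        (blockDiagonal (fun i => fromBlocks ((A₁₁ - A₁₂ * K).map (algebraMap ℝ ℂ)) 0 0
            (diagonal fun j => -((d i * σ j : ℝ) : ℂ))) +
          (blockDiagonal (fun _ => fromBlocks 0 G E P) +
            (diagonal (Sum.elim 0 fun j => (σ j : ℂ))) ⊗ₖ C.map (algebraMap ℝ ℂ))).charpoly := by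
  have hVV : V * V⁻¹ = 1 := mul_nonsing_inv _ (isUnit_iff_ne_zero.2 hV)
  have hBB : B₂ * B₂⁻¹ = 1 := mul_nonsing_inv _ (isUnit_iff_ne_zero.2 hB₂)
  let T : Matrix (Fin p ⊕ Fin m) (Fin p ⊕ Fin m) ℝ := fromBlocks 1 0 (V * K) V
  let T' : Matrix (Fin p ⊕ Fin m) (Fin p ⊕ Fin m) ℝ := fromBlocks 1 0 (-K) V⁻¹
  have hT : T * T' = 1 := by
    simp [T, T', fromBlocks_multiply, hVV]
  let A' := T * fromBlocks A₁₁ A₁₂ A₂₁ A₂₂ * T'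
  have hA' : A'.toBlocks₁₁ = A₁₁ - A₁₂ * K := by
    simp [A', T, T', fromBlocks_multiply, sub_eq_add_neg]
  have hBF : T * (inputMatrix B₂ * gain B₂ V σ K) * T' = diagonal (Sum.elim 0 σ) := by
    have h1 : inputMatrix (p := p) B₂ * gain B₂ V σ K =
        fromBlocks 0 0 (V⁻¹ * diagonal σ * V * K) (V⁻¹ * diagonal σ * V) := by
      rw [inputMatrix, gain, mul_fromCols, fromRows_mul_fromCols]
      simp only [Matrix.zero_mul, Matrix.mul_one, ← Matrix.mul_assoc, hBB, Matrix.one_mul]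
    rw [h1, fromBlocks_multiply, fromBlocks_multiply]
    simp only [Matrix.zero_mul, Matrix.mul_zero, add_zero, zero_add, Matrix.mul_one,
      ← Matrix.mul_assoc, hVV, Matrix.one_mul, Matrix.mul_neg, add_neg_cancel]
    rw [Matrix.mul_assoc _ V, hVV, Matrix.mul_one, ← diagonal_zero, fromBlocks_diagonal]
    rfl
  refine ⟨A'.toBlocks₁₂.map (algebraMap ℝ ℂ), A'.toBlocks₂₁.map (algebraMap ℝ ℂ),
    A'.toBlocks₂₂.map (algebraMap ℝ ℂ), fun d C => ?_⟩
  rw [charpoly_map, charpoly_closedLoop_conj _ _ _ hT, hBF, ← charpoly_map]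
  congr 1
  change ((A' ⊗ₖ 1 - _).map _) = _
  rw [← hA', ← fromBlocks_toBlocks A']
  ext ⟨a | a, i⟩ ⟨b | b, j⟩ <;> by_cases hij : i = j <;>
    simp [blockDiagonal_apply, one_apply, hij]
  all_goals
    by_cases hab : a = b <;> simp [hab]
  ring

theorem RelClose.tendsto_of_const {ι : Type*} {l : Filter ι} {f : ι → ℂ} {w : ℂ}
    (h : RelClose l f fun _ => w) : Tendsto f l (𝓝 w) := by
  rw [tendsto_iff_norm_sub_tendsto_zero]
  have h1 := h.mul_const (1 + ‖w‖)
  rw [zero_mul] at h1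
  refine h1.congr fun t => ?_
  exact div_mul_cancel₀ _ (by positivity)

theorem RelClose.tendsto_div {ι : Type*} {l : Filter ι} {f g : ι → ℂ} (h : RelClose l f g)
    (hg : Tendsto (fun t => ‖g t‖) l atTop) : Tendsto (fun t => f t / g t) l (𝓝 1) := by
  rw [tendsto_iff_norm_sub_tendsto_zero]
  refine squeeze_zero' (Eventually.of_forall fun t => norm_nonneg _) ?_
    (by simpa using h.const_mul 2)
  filter_upwards [hg.eventually_ge_atTop 1] with t ht
  have h0 : g t ≠ 0 := norm_pos_iff.1 (by linarith)
  rw [div_sub_one h0, norm_div, mul_div_assoc', div_le_div_iff₀ (by linarith) (by positivity)]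
  nlinarith [norm_nonneg (f t - g t)]

theorem infinite_det_scalar_sub_ne_zero {p : Type*} [Fintype p] [DecidableEq p]
    (H : Matrix p p ℂ) {ρ : ℂ} (hρ : ρ ≠ 0) : {z | (scalar p (ρ * z) - H).det ≠ 0}.Infinite := by
  have hfin : {z | H.charpoly.IsRoot z}.Finite :=
    Polynomial.finite_setOfPred_isRoot H.charpoly_monic.ne_zero
  have := (hfin.preimage (mul_right_injective₀ hρ).injOn).infinite_compl
  refine this.mono fun z hz => ?_
  simpa [Polynomial.IsRoot, eval_charpoly] using hz

end CoupledLQR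

/-! ### The main theorem -/

open CoupledLQR

theorem theorem2 {p m N : ℕ}
    -- the plant, with state dimension `n = p + m`
    (A₁₁ : Matrix (Fin p) (Fin p) ℝ) (A₁₂ : Matrix (Fin p) (Fin m) ℝ)
    (A₂₁ : Matrix (Fin m) (Fin p) ℝ) (A₂₂ : Matrix (Fin m) (Fin m) ℝ)
    (B₂ : Matrix (Fin m) (Fin m) ℝ) (hB₂ : B₂.det ≠ 0)
    (hstab : CoupledLQR.Stabilizable (Matrix.fromBlocks A₁₁ A₁₂ A₂₁ A₂₂)
      (CoupledLQR.inputMatrix (p := p) B₂))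
    -- the gain
    (V : Matrix (Fin m) (Fin m) ℝ) (hV : V.det ≠ 0)
    (σ : Fin m → ℝ) (hσ : ∀ j, 0 < σ j)
    (K : Matrix (Fin m) (Fin p) ℝ)
    (Q : Matrix (Fin p ⊕ Fin m) (Fin p ⊕ Fin m) ℝ) (hQ : Q.PosSemidef)
    (R : Matrix (Fin m) (Fin m) ℝ) (hR : R.PosDef)
    (hLQR : CoupledLQR.IsLQRSolution (Matrix.fromBlocks A₁₁ A₁₂ A₂₁ A₂₂)
      (CoupledLQR.inputMatrix B₂) Q R (CoupledLQR.gain B₂ V σ K))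
    -- the prescribed stable eigenvalues
    (s : Fin p → ℂ) (hs : ∀ j, (s j).re < 0)
    (hK : CoupledLQR.eigs (A₁₁ - A₁₂ * K) = Finset.univ.val.map s)
    (hsA : ∀ j, s j ∉ CoupledLQR.eigs A₁₁)
    -- self-feedback gains and coupling weights, varying along an arbitrary filter
    {ι : Type*} (l : Filter ι)
    (d : ι → Fin N → ℝ) (hd : ∀ t i, 0 < d t i)
    (C : ι → Matrix (Fin N) (Fin N) ℝ)
    (hC : ∀ t i j, 0 ≤ C t i j) (hCdiag : ∀ t i, C t i i = 0)
    (hdlim : ∀ i, Tendsto (fun t => d t i) l atTop)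
    (hClim : Tendsto (fun t => ‖C t‖) l (𝓝 0)) :
    -- an enumeration of all eigenvalues, with multiplicity, of the closed loop
    ∃ ev : ι → Fin N → Fin p ⊕ Fin m → ℂ,
      (∀ t, CoupledLQR.eigs (CoupledLQR.closedLoop (Matrix.fromBlocks A₁₁ A₁₂ A₂₁ A₂₂)
          (CoupledLQR.inputMatrix B₂) (CoupledLQR.gain B₂ V σ K) (d t) (C t)) =
        (Finset.univ : Finset (Fin N × (Fin p ⊕ Fin m))).val.map (fun q => ev t q.1 q.2)) ∧
      -- slow eigenvalues
      (∀ i j, Tendsto (fun t => ev t i (Sum.inl j)) l (𝓝 (s j))) ∧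
      -- fast eigenvalues
      (∀ i j, Tendsto (fun t => ev t i (Sum.inr j) / (-((d t i * σ j : ℝ) : ℂ))) l (𝓝 1)) ∧
      -- dominance of the slow eigenvalues
      (∀ i j i' j', Tendsto
        (fun t => (ev t i (Sum.inl j)).re - (ev t i' (Sum.inr j')).re) l atTop) := by
  obtain ⟨G, E, P, hchar⟩ := exists_charpoly_closedLoop (N := N) A₁₁ A₁₂ A₂₁ A₂₂ hB₂ hV σ K
  choose f hf using fun t => exists_eigs_eq (closedLoop (fromBlocks A₁₁ A₁₂ A₂₁ A₂₂)
    (inputMatrix B₂) (gain B₂ V σ K) (d t) (C t))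
  let ν : Fin N × (Fin p ⊕ Fin m) → ι → ℂ := fun q t =>
    Sum.elim s (fun j => -((d t q.1 * σ j : ℝ) : ℂ)) q.2
  set H := (A₁₁ - A₁₂ * K).map (algebraMap ℝ ℂ) with hHdef
  let μ : ι → Fin N → Fin m → ℂ := fun t i j => -((d t i * σ j : ℝ) : ℂ)
  let Δ : ι → Matrix ((Fin p ⊕ Fin m) × Fin N) ((Fin p ⊕ Fin m) × Fin N) ℂ := fun t =>
    blockDiagonal (fun _ => fromBlocks 0 G E P) +
      (diagonal (Sum.elim 0 fun j => (σ j : ℂ))) ⊗ₖ (C t).map (algebraMap ℝ ℂ)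
  have hdσ : ∀ i j, Tendsto (fun t => d t i * σ j) l atTop := fun i j =>
    (hdlim i).atTop_mul_const (hσ j)
  have hnorm : ∀ t i j, ‖μ t i j‖ = d t i * σ j := fun t i j => by
    rw [norm_neg, Complex.norm_real, Real.norm_of_nonneg (mul_pos (hd t i) (hσ j)).le]
  have hΔ : Tendsto Δ l (𝓝 (blockDiagonal fun _ => fromBlocks 0 G E P)) := by
    have hcont : Continuous fun c : Matrix (Fin N) (Fin N) ℝ =>
        blockDiagonal (fun _ => fromBlocks 0 G E P) +
        (diagonal (Sum.elim 0 fun j => (σ j : ℂ))) ⊗ₖ c.map (algebraMap ℝ ℂ) := by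
      refine continuous_const.add (continuous_matrix fun a b => ?_)
      exact continuous_const.mul
        (Complex.continuous_ofReal.comp (continuous_id.matrix_elem a.2 b.2))
    have h0 := (hcont.tendsto 0).comp (tendsto_zero_iff_norm_tendsto_zero.2 hClim)
    have hz : (0 : Matrix (Fin N) (Fin N) ℝ).map (algebraMap ℝ ℂ) = 0 :=
      Matrix.map_zero _ (map_zero _)
    rw [hz, kronecker_zero, add_zero] at h0
    exact h0
  have hnum : ∀ t u, ∏ q, (u - f t q) = (blockDiagonal (fun i => fromBlocks H 0 0
      (diagonal (μ t i))) + Δ t).charpoly.eval u := fun t u => by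
    rw [← eval_charpoly_eq_prod_of_eigs (hf t), hchar]
  have hden : ∀ t u, ∏ q, (u - ν q t) =
      ∏ i, (fromBlocks H 0 0 (diagonal (μ t i))).charpoly.eval u := fun t u => by
    rw [Fintype.prod_prod_type]
    refine Finset.prod_congr rfl fun i _ => ?_
    rw [charpoly_fromBlocks_zero₁₂, Polynomial.eval_mul, charpoly_diagonal,
      eval_charpoly_eq_prod_of_eigs hK, Fintype.prod_sum_type, Polynomial.eval_prod]
    simp [ν, μ]
  obtain ⟨π, hπ⟩ := exists_relabel_relClose l (fun q t => f t q) ν (by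
    simp only [hnum, hden]
    rintro ⟨i, j | j⟩
    · have hρ : ((1 + ‖s j‖ : ℝ) : ℂ) ≠ 0 := by
        rw [Complex.ofReal_ne_zero]; positivity
      refine ⟨_, infinite_det_scalar_sub_ne_zero H hρ, fun z hz => ?_⟩
      refine tendsto_charpoly_ratio_const hΔ hz fun i j => ?_
      rw [← tendsto_norm_atTop_iff_cobounded]
      simpa only [hnorm] using hdσ i j
    -- The fast eigenvalues of `Y` are real, while `ρ (n + i)` has imaginary part `ρ → ∞`. These
    -- points thus recede from all of them, however the `dᵢ` compare.
    · have hinj : Function.Injective fun n : ℕ => (n : ℂ) + Complex.I := fun a b hab => by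
        simpa using hab
      refine ⟨_, Set.infinite_range_of_injective hinj, ?_⟩
      rintro _ ⟨n, rfl⟩
      have hfar : ∀ x : ι → ℝ, Tendsto (fun t => ((1 + ‖ν (i, Sum.inr j) t‖ : ℝ) : ℂ) *
          ((n : ℂ) + Complex.I) - x t) l (Bornology.cobounded ℂ) := fun x => by
        rw [← tendsto_norm_atTop_iff_cobounded]
        refine tendsto_atTop_mono (fun t => ?_) (hdσ i j)
        refine le_trans ?_ (Complex.abs_im_le_norm _)
        have h1 : ‖ν (i, Sum.inr j) t‖ = d t i * σ j := hnorm t i j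
        rw [h1]
        refine le_trans ?_ (le_abs_self _)
        simp
      refine tendsto_charpoly_ratio_cobounded hΔ ?_ fun i' j' => ?_
      · simpa using hfar 0
      · simpa only [μ, Complex.ofReal_neg] using hfar fun t => -(d t i' * σ j'))
  have hfast : ∀ i j, Tendsto (fun t => f t (π t (i, Sum.inr j)) / (-((d t i * σ j : ℝ) : ℂ))) l
      (𝓝 1) := fun i j => by
    refine (hπ (i, Sum.inr j)).tendsto_div ?_
    change Tendsto (fun t => ‖μ t i j‖) l atTop
    simpa only [hnorm] using hdσ i j
  have hslow : ∀ i j, Tendsto (fun t => f t (π t (i, Sum.inl j))) l (𝓝 (s j)) := fun i j =>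
    (hπ (i, Sum.inl j)).tendsto_of_const
  refine ⟨fun t i a => f t (π t (i, a)), fun t => ?_, hslow, hfast, fun i j i' j' => ?_⟩
  · rw [hf t]
    change _ = Finset.univ.val.map (f t ∘ π t)
    rw [← Multiset.map_map, Multiset.map_univ_val_equiv]
  -- Minus the real part of a fast eigenvalue is `dσ` times the real part of a ratio tending to 1.
  · have h1 := (Complex.continuous_re.tendsto _).comp (hslow i j)
    have h2 := ((Complex.continuous_re.tendsto _).comp (hfast i' j')).pos_mul_atTop
      (by simp) (hdσ i' j')
    refine (h1.add_atTop h2).congr fun t => ?_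
    have h0 : d t i' * σ j' ≠ 0 := (mul_pos (hd t i') (hσ j')).ne'
    simp only [Function.comp, ← Complex.ofReal_neg, Complex.div_ofReal_re]
    rw [div_neg, neg_mul, div_mul_cancel₀ _ h0, sub_eq_add_neg]
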